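/- Let $\mathcal{D}\subseteq\mathbb{R}^n$ be open and connected with $0\in\mathcal{D}$, fix $t_0\in\mathbb{R}$, and let $F:\mathbb{R}^n\rightrightarrows\mathbb{R}^n$ be a set-valued map that is locally bounded and outer semicontinuous at every point of $\mathcal{D}$ and such that $F(x)$ is nonempty, convex and compact for every $x\in\mathcal{D}$. Consider the differential inclusion $\dot x\in F(x)$. A solution over $\mathcal{I}=[t_0,T)$, $t_0<T\le\infty$, is a locally absolutely continuous $x:\mathcal{I}\to\mathbb{R}^n$ with $\dot x(t)\in F(x(t))$ for almost all $t\in\mathcal{I}$. It is complete if $T=\infty$, and maximal if it has no proper right extension that is also a solution. The inclusion is *stable* at $0$ if for every $\epsilon>0$ there is $\delta>0$ such that every maximal solution with $\|x(t_0)\|\le\delta$ is complete and satisfies $\|x(t)\|\le\epsilon$ for all $t\ge t_0$. It is *asymptotically stable* at $0$ if it is stable at $0$ and there is $c>0$ such that every maximal solution with $\|x(t_0)\|\le c$ is complete and satisfies $\lim_{t\to\infty}\|x(t)\|=0$. It is *globally asymptotically stable* at $0$ if it is stable at $0$ and every maximal solution is complete and satisfies $\lim_{t\to\infty}\|x(t)\|=0$.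 For a locally Lipschitz $W:\mathcal{D}\to\mathbb{R}$, let $$\partial W(x)=\overline{\mathrm{co}}\{\lim_{i}\nabla W(x_i) : x_i\to x,\ W\text{ differentiable at each }x_i\}$$ denote the Clarke gradient, and call $W$ regular if for all $x\in\mathcal{D}$ and $v\in\mathbb{R}^n$ the one-sided directional derivative $\lim_{h\downarrow0}\frac{W(x+hv)-W(x)}{h}$ exists and equals $\limsup_{y\to x,\,h\downarrow0}\frac{W(y+hv)-W(y)}{h}$. Let $\mathcal{U}=\{U_i\}_{i=1}^\infty$ be a collection of locally Lipschitz regular functions $U_i:\mathcal{D}\to\mathbb{R}$, and set $$\tilde F_{\mathcal{U}}(x)=\bigcap_{i=1}^\infty\{q\in F(x) : \exists a\in\mathbb{R},\ p^Tq=a\ \ \forall p\in\partial U_i(x)\}.$$ For a locally Lipschitz $V:\mathcal{D}\to\mathbb{R}$, the $\mathcal{U}$-generalized derivative of $V$ in the directions $F$ is $$\dot{\overline V}_{\mathcal{U}}(x)=\min_{p\in\partial V(x)}\ \max_{q\in\tilde F_{\mathcal{U}}(x)}p^Tq\ \text{ if }V\text{ is regular},\qquad \dot{\overline V}_{\mathcal{U}}(x)=\max_{p\in\partial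 V(x)}\ \max_{q\in\tilde F_{\mathcal{U}}(x)}p^Tq\ \text{ if not},$$ and it is $-\infty$ where $\tilde F_{\mathcal{U}}(x)=\emptyset$. Let $V:\mathcal{D}\to\mathbb{R}$ be locally Lipschitz and positive definite ($V(0)=0$ and $V(x)>0$ for $x\in\mathcal{D}\setminus\{0\}$). Suppose that $\dot{\overline V}_{\mathcal{U}}(x)\le0$ for all $x\in\mathcal{D}$, and that for each $\nu>0$ no complete solution of $\dot x\in F(x)$ remains in the level set $\{x\in\mathcal{D} : V(x)=\nu\}$ for all $t\ge t_0$. Then $\dot x\in F(x)$ is asymptotically stable at $0$. If, in addition, $\mathcal{D}=\mathbb{R}^n$ and the sublevel sets $\{x\in\mathbb{R}^n : V(x)\le l\}$ are compact for all $l\ge0$, then $\dot x\in F(x)$ is globally asymptotically stable at $0$. -/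

import Mathlib

open Set Filter Topology MeasureTheory

namespace DiffIncl

variable {E : Type*} [NormedAddCommGroup E] [InnerProductSpace ℝ E]

/-! ### Set-valued maps -/

/-- `F` is locally bounded over `D`: every point of `D` has a neighborhood `N` such that
`⋃ y ∈ N, F y` is bounded. -/
def LocallyBoundedOver (F : E → Set E) (D : Set E) : Prop :=
  ∀ x ∈ D, ∃ N ∈ 𝓝 x, Bornology.IsBounded (⋃ y ∈ N, F y)

/-- `F` is outer semicontinuous over `D`: the outer limit of `F` at each `x ∈ D` is contained in
`F x`, that is, whenever `u i → x`, `q i ∈ F (u i)` and `q i → v`, one has `v ∈ F x`. -/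
def OuterSemicontinuousOver (F : E → Set E) (D : Set E) : Prop :=
  ∀ x ∈ D, ∀ (u q : ℕ → E) (v : E), Tendsto u atTop (𝓝 x) → (∀ i, q i ∈ F (u i)) →
    Tendsto q atTop (𝓝 v) → v ∈ F x

/-! ### Solutions of `x' ∈ F x`

A solution starts at time `t₀` and lives on a right-open interval `[t₀, T)` with
`t₀ < T ≤ ∞`; it is represented by the pair of `T : EReal` and a function `x : ℝ → E` of which only
the values on `[t₀, T)` matter. -/

/-- The interval `[t₀, T)`. -/
def timeInterval (t₀ : ℝ) (T : EReal) : Set ℝ :=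
  {t : ℝ | t₀ ≤ t ∧ (t : EReal) < T}

/-- `x` is a solution of `x' ∈ F x` over `[t₀, T)`: it is locally absolutely continuous there
and `x' t ∈ F (x t)` for almost every `t ∈ [t₀, T)`. -/
def IsSolution (F : E → Set E) (t₀ : ℝ) (T : EReal) (x : ℝ → E) : Prop :=
  (t₀ : EReal) < T ∧
  (∀ b ∈ timeInterval t₀ T, AbsolutelyContinuousOnInterval x t₀ b) ∧
  ∀ᵐ t ∂volume, t ∈ timeInterval t₀ T → DifferentiableAt ℝ x t ∧ deriv x t ∈ F (x t)

/-- A solution over `[t₀, T)` is maximal if it has no proper right extension that is also a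
solution. It is complete if `T = ⊤`. -/
def IsMaximalSolution (F : E → Set E) (t₀ : ℝ) (T : EReal) (x : ℝ → E) : Prop :=
  IsSolution F t₀ T x ∧
  ∀ (T' : EReal) (y : ℝ → E), IsSolution F t₀ T' y → T ≤ T' →
    (∀ t ∈ timeInterval t₀ T, y t = x t) → T' = T

/-! ### Stability at the origin -/

/-- Stability of `x' ∈ F x` at `0`. -/
def IsStable (F : E → Set E) (t₀ : ℝ) : Prop :=
  ∀ ε > 0, ∃ δ > 0, ∀ (T : EReal) (x : ℝ → E), IsMaximalSolution F t₀ T x →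
    x t₀ ∈ Metric.closedBall 0 δ → T = ⊤ ∧ ∀ t ≥ t₀, x t ∈ Metric.closedBall 0 ε

/-- Asymptotic stability of `x' ∈ F x` at `0`. -/
def IsAsymptoticallyStable (F : E → Set E) (t₀ : ℝ) : Prop :=
  IsStable F t₀ ∧ ∃ c > 0, ∀ (T : EReal) (x : ℝ → E), IsMaximalSolution F t₀ T x →
    x t₀ ∈ Metric.closedBall 0 c → T = ⊤ ∧ Tendsto (fun t => ‖x t‖) atTop (𝓝 0)

/-- Global asymptotic stability of `x' ∈ F x` at `0`. -/
def IsGloballyAsymptoticallyStable (F : E → Set E) (t₀ : ℝ) : Prop :=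
  IsStable F t₀ ∧ ∀ (T : EReal) (x : ℝ → E), IsMaximalSolution F t₀ T x →
    T = ⊤ ∧ Tendsto (fun t => ‖x t‖) atTop (𝓝 0)

/-! ### Clarke's nonsmooth calculus

Functions on an open set `D` are represented by total functions; the notions below
at a point of `D` depend only on the values near that point. -/

/-- Positive definiteness on `D`. -/
def PositiveDefiniteOn (V : E → ℝ) (D : Set E) : Prop :=
  V 0 = 0 ∧ ∀ x ∈ D, x ≠ 0 → 0 < V x

/-- The Clarke gradient: the closed convex hull of all limits of gradients `∇V (u i)` along
sequences `u i → x` of points at which `V` is differentiable. -/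
def clarkeGradient [CompleteSpace E] (V : E → ℝ) (x : E) : Set E :=
  closure (convexHull ℝ {p : E | ∃ u : ℕ → E, Tendsto u atTop (𝓝 x) ∧
    (∀ i, DifferentiableAt ℝ V (u i)) ∧ Tendsto (fun i => gradient V (u i)) atTop (𝓝 p)})

/-- Clarke's generalized directional derivative
`V°(x; v) = limsup_{y → x, h ↓ 0} (V (y + h v) - V y) / h`. -/
noncomputable def clarkeDirDeriv (V : E → ℝ) (x v : E) : ℝ :=
  limsup (fun z : E × ℝ => (V (z.1 + z.2 • v) - V z.1) / z.2) (𝓝 x ×ˢ 𝓝[>] (0 : ℝ))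

/-- Regularity on `D`: at every `x ∈ D` and for every `v`, the one-sided directional derivative
exists and equals `V°(x; v)`. -/
def RegularOn (V : E → ℝ) (D : Set E) : Prop :=
  ∀ x ∈ D, ∀ v : E,
    Tendsto (fun h : ℝ => (V (x + h • v) - V x) / h) (𝓝[>] 0) (𝓝 (clarkeDirDeriv V x v))

/-! ### The reduced inclusion and the generalized derivative -/

/-- The reduction `G_U^F (x)`: the directions in `F x` on which all of `∂U(x)` agrees. -/
def reduction [CompleteSpace E] (F : E → Set E) (U : E → ℝ) (x : E) : Set E :=
  {q ∈ F x | ∃ a : ℝ, ∀ p ∈ clarkeGradient U x, inner ℝ p q = a}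

/-- The `𝒰`-reduced differential inclusion `⋂ i, G_{U i}^F (x)`. -/
def reducedInclusion [CompleteSpace E] (F : E → Set E) (U : ℕ → E → ℝ) (x : E) : Set E :=
  ⋂ i, reduction F (U i) x

open Classical in
/-- The `𝒰`-generalized derivative of `V : D → ℝ` in the directions `F`:
`min_{p ∈ ∂V(x)} max_q pᵀq` if `V` is regular on `D` and `max_{p ∈ ∂V(x)} max_q pᵀq` otherwise,
with `q` ranging over the reduced inclusion at `x`. For locally Lipschitz `V` and compact `F x` the
sets involved are compact and `∂V(x)` is nonempty, so the infima and suprema in `EReal` are the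
minima and maxima, and the value is `-∞` when the reduced inclusion at `x` is empty. -/
noncomputable def genDeriv [CompleteSpace E] (D : Set E) (F : E → Set E) (U : ℕ → E → ℝ)
    (V : E → ℝ) (x : E) : EReal :=
  if RegularOn V D then
    ⨅ p ∈ clarkeGradient V x, ⨆ q ∈ reducedInclusion F U x, ((inner ℝ p q : ℝ) : EReal)
  else
    ⨆ p ∈ clarkeGradient V x, ⨆ q ∈ reducedInclusion F U x, ((inner ℝ p q : ℝ) : EReal)

end DiffIncl

namespace DiffIncl

variable {E : Type*} [NormedAddCommGroup E] [InnerProductSpace ℝ E]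

/-! ### Absolutely continuous functions -/

/-! The heart is that `V` does not increase along solutions in `D` (`lyapunov_le`). For almost every
`t`, `V ∘ x` and the countably many `U i ∘ x` are all differentiable, so each of these functions has
a two-sided line derivative at `x t` in the direction `v = x' t`. For a regular function this forces
all Clarke subgradients to have the same product with `v` (`inner_eq_of_regular`). Hence `v` lies in
the reduced inclusion, and the hypothesis bounds the derivative of `V ∘ x`: if `V` is regular all
`p` agree, so the minimum over `p` suffices; otherwise the maximum over `p` dominates the line
derivative (`lineDeriv_le_of_inner_le`).

Stability is then Lyapunov's barrier argument, and maximal solutions trapped in a compact set are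
complete because they could otherwise be extended. Convergence is LaSalle's argument: `V (x t)`
tends to some `ν`, and a limit of translates of `x` is a complete solution inside `V = ν`, so `ν =
0`.

Local existence and the limit of translates both rest on `hasSlopesIn_of_tendsto`. Derivatives do
not pass to pointwise limits, but difference quotients do, and convexity of `F` keeps them near `F
(y t)`. -/

theorem sub_le_of_deriv_le {f : ℝ → ℝ} {a b c : ℝ} (hab : a ≤ b)
    (hf : AbsolutelyContinuousOnInterval f a b)
    (hc : ∀ᵐ t, t ∈ Icc a b → deriv f t ≤ c) : f b - f a ≤ c * (b - a) := by
  rw [← hf.integral_deriv_eq_sub]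
  have h := intervalIntegral.integral_mono_ae_restrict hab hf.intervalIntegrable_deriv
    (intervalIntegrable_const (c := c)) ((ae_restrict_iff' measurableSet_Icc).2 hc)
  simpa [mul_comm] using h

theorem _root_.AbsolutelyContinuousOnInterval.clm_comp {x : ℝ → E} {a b : ℝ}
    (hx : AbsolutelyContinuousOnInterval x a b) (φ : E →L[ℝ] ℝ) :
    AbsolutelyContinuousOnInterval (fun t => φ (x t)) a b := by
  unfold AbsolutelyContinuousOnInterval at hx ⊢
  have h := Tendsto.const_mul ‖φ‖ hx
  rw [mul_zero] at h
  refine squeeze_zero (fun t => Finset.sum_nonneg fun i _ => dist_nonneg) (fun t => ?_) h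
  rw [Finset.mul_sum]
  gcongr
  exact φ.lipschitz.dist_le_mul _ _

/-- Otherwise a functional separates the slope from `C`, and integrating its derivative along `x`
gives a contradiction. -/
theorem slope_mem_of_deriv_mem {x : ℝ → E} {a b : ℝ} (hab : a < b)
    (hx : AbsolutelyContinuousOnInterval x a b) {C : Set E} (hCc : Convex ℝ C)
    (hC : IsClosed C) (h : ∀ᵐ t, t ∈ Icc a b → DifferentiableAt ℝ x t ∧ deriv x t ∈ C) :
    slope x a b ∈ C := by
  by_contra hn
  obtain ⟨φ, u, hu, hlt⟩ := geometric_hahn_banach_closed_point hCc hC hn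
  have key : φ (x b) - φ (x a) ≤ u * (b - a) := by
    refine sub_le_of_deriv_le hab.le (hx.clm_comp φ) ?_
    filter_upwards [h] with t ht hmem
    obtain ⟨hd, hm⟩ := ht hmem
    have : deriv (fun t => φ (x t)) t = φ (deriv x t) :=
      (φ.hasFDerivAt.comp_hasDerivAt t hd.hasDerivAt).deriv
    rw [this]
    exact (hu _ hm).le
  have hpos : 0 < b - a := sub_pos.2 hab
  rw [slope_def_module, map_smul, map_sub, smul_eq_mul, inv_mul_eq_div, lt_div_iff₀ hpos] at hlt
  linarith

/-! ### Lipschitz functions and the Clarke gradient -/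

theorem tendsto_add_smul (x v : E) :
    Tendsto (fun z : E × ℝ => z.1 + z.2 • v) (𝓝 x ×ˢ 𝓝[>] (0 : ℝ)) (𝓝 x) := by
  have h : Tendsto (fun z : E × ℝ => z.1 + z.2 • v) (𝓝 (x, (0 : ℝ))) (𝓝 (x + (0 : ℝ) • v)) :=
    Continuous.tendsto (by fun_prop) _
  rw [zero_smul, add_zero, nhds_prod_eq] at h
  exact h.mono_left (prod_mono le_rfl nhdsWithin_le_nhds)

theorem isBoundedUnder_diffQuotient {V : E → ℝ} {x : E} {B : Set E} {K : NNReal}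
    (hB : B ∈ 𝓝 x) (hV : LipschitzOnWith K V B) (v : E) :
    IsBoundedUnder (· ≤ ·) (𝓝 x ×ˢ 𝓝[>] (0 : ℝ))
      (fun z : E × ℝ => (V (z.1 + z.2 • v) - V z.1) / z.2) := by
  refine ⟨K * ‖v‖, ?_⟩
  rw [eventually_map]
  filter_upwards [tendsto_fst.eventually hB, (tendsto_add_smul x v).eventually hB,
    tendsto_snd.eventually self_mem_nhdsWithin] with z h1 h2 h3
  have h3 : 0 < z.2 := h3
  rw [div_le_iff₀ h3]
  have := hV.dist_le_mul _ h2 _ h1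
  rw [dist_self_add_left, norm_smul, Real.norm_eq_abs, abs_of_pos h3, Real.dist_eq] at this
  calc _ ≤ _ := le_abs_self _
    _ ≤ _ := this
    _ = _ := by ring

/-- The bound cuts out a closed half-space of `p`, so only limits of gradients matter. Each gradient
is computed by difference quotients at nearby points, which the limsup controls. -/
theorem inner_le_clarkeDirDeriv [CompleteSpace E] {V : E → ℝ} {x : E} {B : Set E} {K : NNReal}
    (hB : B ∈ 𝓝 x) (hV : LipschitzOnWith K V B) {p : E} (hp : p ∈ clarkeGradient V x) (v : E) :
    inner ℝ p v ≤ clarkeDirDeriv V x v := by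
  have hconv : Convex ℝ {p : E | inner ℝ p v ≤ clarkeDirDeriv V x v} := by
    have := (convex_halfSpace_le (𝕜 := ℝ) (f := fun p : E => (inner ℝ p v : ℝ))
      ⟨fun a b => inner_add_left _ _ _, fun c a => by simp [inner_smul_left]⟩
      (clarkeDirDeriv V x v))
    exact this
  have hcl : IsClosed {p : E | inner ℝ p v ≤ clarkeDirDeriv V x v} :=
    isClosed_le (by fun_prop) continuous_const
  refine closure_minimal (convexHull_min ?_ hconv) hcl hp
  rintro p ⟨u, hu, hd, hlim⟩
  change (inner ℝ p v : ℝ) ≤ clarkeDirDeriv V x v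
  refine le_of_forall_pos_lt_add fun ε hε => ?_
  have hev : ∀ᶠ z : E × ℝ in 𝓝 x ×ˢ 𝓝[>] (0 : ℝ),
      (V (z.1 + z.2 • v) - V z.1) / z.2 < clarkeDirDeriv V x v + ε / 2 :=
    eventually_lt_of_limsup_lt (by unfold clarkeDirDeriv; linarith)
      (isBoundedUnder_diffQuotient hB hV v)
  have hle : ∀ᶠ i in atTop, inner ℝ (gradient V (u i)) v ≤ clarkeDirDeriv V x v + ε / 2 := by
    filter_upwards [hu.eventually hev.curry] with i hi
    rw [inner_gradient_left]
    refine le_of_tendsto ((hd i).hasFDerivAt.hasLineDerivAt v).tendsto_slope_zero_right ?_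
    filter_upwards [hi] with h hh
    rw [smul_eq_mul, inv_mul_eq_div]
    exact hh.le
  have := le_of_tendsto (hlim.inner tendsto_const_nhds) hle
  linarith

/-- The chain rule for a Lipschitz function along a differentiable curve. -/
theorem hasLineDerivAt_of_comp {V : E → ℝ} {x : ℝ → E} {t d : ℝ} {v : E} {B : Set E}
    {K : NNReal} (hB : B ∈ 𝓝 (x t)) (hV : LipschitzOnWith K V B) (hx : HasDerivAt x v t)
    (hd : HasDerivAt (fun s => V (x s)) d t) : HasLineDerivAt ℝ V d (x t) v := by
  have hd' : HasDerivAt (fun h => V (x (t + h))) d 0 := by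
    have : HasDerivAt (fun s => V (x s)) d (t + 0) := by simpa using hd
    simpa using this.comp_const_add t 0
  -- The curve and its tangent line differ by `o(h)`, hence so do the values of the Lipschitz
  -- function `V`.
  have hg : HasDerivAt (fun h : ℝ => V (x t + h • v) - V (x (t + h))) 0 0 := by
    rw [hasDerivAt_iff_isLittleO_nhds_zero]
    have hlo := hasDerivAt_iff_isLittleO_nhds_zero.1 hx
    refine (Asymptotics.IsBigO.trans_isLittleO ?_ hlo)
    refine Asymptotics.IsBigO.of_bound K ?_
    have h1 : Tendsto (fun h : ℝ => x (t + h)) (𝓝 0) (𝓝 (x t)) := by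
      have h0 : ContinuousAt x (t + 0) := by simpa using hx.continuousAt
      have h2 : ContinuousAt (fun h : ℝ => x (t + h)) 0 :=
        ContinuousAt.comp (g := x) h0 (by fun_prop)
      simpa [ContinuousAt] using h2
    have h2 : Tendsto (fun h : ℝ => x t + h • v) (𝓝 0) (𝓝 (x t)) := by
      have : Continuous (fun h : ℝ => x t + h • v) := by fun_prop
      simpa using this.tendsto 0
    filter_upwards [h1.eventually hB, h2.eventually hB] with h hh1 hh2
    have := hV.dist_le_mul _ hh2 _ hh1
    rw [Real.dist_eq, dist_eq_norm, ← norm_neg] at this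
    simpa [sub_eq_add_neg, add_comm, add_left_comm, add_assoc] using this
  have := hg.add hd'
  unfold HasLineDerivAt
  convert this using 1
  · ext h; simp
  · simp

/-- By regularity the generalized derivatives in the directions `v` and `-v` are `d` and `-d`;
bounding `p` in both squeezes the product to `d`. -/
theorem inner_eq_of_regular [CompleteSpace E] {V : E → ℝ} {x p v : E} {d : ℝ} {B : Set E}
    {K : NNReal} (hB : B ∈ 𝓝 x) (hV : LipschitzOnWith K V B)
    (hreg : ∀ w : E, Tendsto (fun h : ℝ => (V (x + h • w) - V x) / h) (𝓝[>] 0)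
      (𝓝 (clarkeDirDeriv V x w)))
    (hd : HasLineDerivAt ℝ V d x v) (hp : p ∈ clarkeGradient V x) : inner ℝ p v = d := by
  have key : ∀ w e, HasLineDerivAt ℝ V e x w → inner ℝ p w ≤ e := by
    intro w e he
    have h1 := he.tendsto_slope_zero_right
    have h2 := hreg w
    have : clarkeDirDeriv V x w = e := by
      refine tendsto_nhds_unique h2 (h1.congr fun h => ?_)
      rw [smul_eq_mul, inv_mul_eq_div]
    exact this ▸ inner_le_clarkeDirDeriv hB hV hp w
  have h1 := key v d hd
  have h2 := key ((-1 : ℝ) • v) ((-1 : ℝ) • d) (hd.smul (-1))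
  simp only [neg_smul, one_smul, inner_neg_right] at h2
  linarith

/-! ### Line derivatives of nonregular functions, via Rademacher's theorem -/

variable [FiniteDimensional ℝ E]

/-- Upper semicontinuity of the Clarke gradient: gradients at violating points are bounded by `K`,
so a subsequence converges to an element of `∂V(x)` that violates the bound. -/
theorem exists_fderiv_le_of_inner_le {V : E → ℝ} {x v : E} {B : Set E} {K : NNReal}
    (hB : B ∈ 𝓝 x) (hV : LipschitzOnWith K V B) {c ε : ℝ} (hε : 0 < ε)
    (hp : ∀ p ∈ clarkeGradient V x, inner ℝ p v ≤ c) :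
    ∀ᶠ y in 𝓝 x, DifferentiableAt ℝ V y → fderiv ℝ V y v ≤ c + ε := by
  by_contra hcon
  obtain ⟨u, hu, hn⟩ := exists_seq_forall_of_frequently (not_eventually.1 hcon)
  push Not at hn
  have hbd : ∃ᶠ n in atTop, gradient V (u n) ∈ Metric.closedBall (0 : E) K := by
    refine Eventually.frequently ?_
    filter_upwards [hu.eventually (eventually_mem_nhds_iff.2 hB)] with n hn
    rw [mem_closedBall_zero_iff, gradient, LinearIsometryEquiv.norm_map]
    exact norm_fderiv_le_of_lipschitzOn ℝ hn hV
  obtain ⟨p, -, φ, hφ, hlim⟩ :=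
    tendsto_subseq_of_frequently_bounded Metric.isBounded_closedBall hbd
  have hmem : p ∈ clarkeGradient V x := subset_closure <| subset_convexHull _ _
    ⟨u ∘ φ, hu.comp hφ.tendsto_atTop, fun i => (hn _).1, hlim⟩
  have : c + ε ≤ inner ℝ p v := by
    refine ge_of_tendsto (hlim.inner (tendsto_const_nhds (x := v))) (Eventually.of_forall fun i => ?_)
    rw [Function.comp_apply, inner_gradient_left]
    exact (hn _).2.le
  linarith [hp p hmem]

/-- A mean value inequality: the bound is required only at points of differentiability. -/
theorem sub_le_of_fderiv_le {V : E → ℝ} {x v : E} {r c : ℝ} {K : NNReal}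
    (hV : LipschitzOnWith K V (Metric.ball x r))
    (hc : ∀ y ∈ Metric.ball x r, DifferentiableAt ℝ V y → fderiv ℝ V y v ≤ c)
    {h : ℝ} (hh : 0 ≤ h) {y : E} (hy : y ∈ Metric.ball x r) (hyh : y + h • v ∈ Metric.ball x r) :
    V (y + h • v) - V y ≤ c * h := by
  borelize E
  have hN : ∀ᵐ z : E, z ∈ Metric.ball x r → DifferentiableAt ℝ V z := by
    filter_upwards [hV.ae_differentiableWithinAt_of_mem] with z hz hmem
    exact (hz hmem).differentiableAt (Metric.isOpen_ball.mem_nhds hmem)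
  have hmeas : MeasurableSet {z : E | z ∈ Metric.ball x r → DifferentiableAt ℝ V z} := by
    have : {z : E | z ∈ Metric.ball x r → DifferentiableAt ℝ V z} =
        (Metric.ball x r)ᶜ ∪ {z | DifferentiableAt ℝ V z} := by
      ext z; simp [imp_iff_not_or]
    rw [this]
    exact Metric.isOpen_ball.measurableSet.compl.union (measurableSet_of_differentiableAt ℝ V)
  -- Rademacher and Fubini: almost every line parallel to `v` meets the nondifferentiability set in
  -- a null set.
  have hae : ∀ᵐ y : E, ∀ᵐ s : ℝ, y + s • v ∈ Metric.ball x r → DifferentiableAt ℝ V (y + s • v) := by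
    rw [← Measure.ae_ae_comm (p := fun (s : ℝ) (y : E) =>
      y + s • v ∈ Metric.ball x r → DifferentiableAt ℝ V (y + s • v))]
    · refine Eventually.of_forall fun s => ?_
      exact (measurePreserving_add_right volume (s • v)).quasiMeasurePreserving.ae hN
    · have : Measurable fun z : ℝ × E => z.2 + z.1 • v := by fun_prop
      exact this hmeas
  have hgood : ∀ y ∈ Metric.ball x r, y + h • v ∈ Metric.ball x r →
      (∀ᵐ s : ℝ, y + s • v ∈ Metric.ball x r → DifferentiableAt ℝ V (y + s • v)) →
      V (y + h • v) - V y ≤ c * h := by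
    intro y hy hyh hs
    have hseg : ∀ s ∈ Icc 0 h, y + s • v ∈ Metric.ball x r := by
      intro s hs
      rcases hh.eq_or_lt with rfl | hpos
      · have : s = 0 := le_antisymm hs.2 hs.1
        simpa [this] using hy
      · have := (convex_ball x r).add_smul_mem hy hyh (t := s / h)
          ⟨div_nonneg hs.1 hpos.le, div_le_one_of_le₀ hs.2 hpos.le⟩
        rwa [smul_smul, div_mul_cancel₀ _ hpos.ne'] at this
    have hlip : LipschitzOnWith (K * ‖v‖₊) (fun s : ℝ => V (y + s • v)) (uIcc 0 h) := by
      refine hV.comp (t := Metric.ball x r) (LipschitzWith.lipschitzOnWith ?_) ?_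
      · refine LipschitzWith.of_dist_le_mul fun s s' => ?_
        rw [dist_add_left, dist_eq_norm, ← sub_smul, norm_smul, mul_comm, dist_eq_norm]
        rfl
      · rw [uIcc_of_le hh]; exact hseg
    have := sub_le_of_deriv_le (c := c) hh hlip.absolutelyContinuousOnInterval ?_
    · simpa using this
    filter_upwards [hs] with s hs hmem
    have hb := hseg s hmem
    have hd := hs hb
    have h1 : HasDerivAt (fun s : ℝ => V (y + s • v)) (fderiv ℝ V (y + s • v) v) s := by
      have h2 : HasDerivAt (fun s : ℝ => y + s • v) v s := by
        simpa using ((hasDerivAt_id s).smul_const v).const_add y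
      exact hd.hasFDerivAt.comp_hasDerivAt s h2
    rw [h1.deriv]
    exact hc _ hb hd
  -- The good base points are dense, so continuity of `V` carries the inequality to every `y`.
  have hdense := Measure.dense_of_ae hae
  by_contra! hlt
  have hcont : ContinuousAt (fun y => V (y + h • v) - V y) y := by
    refine ContinuousAt.sub ?_ (hV.continuousOn.continuousAt (Metric.isOpen_ball.mem_nhds hy))
    exact ContinuousAt.comp (g := V)
      (hV.continuousOn.continuousAt (Metric.isOpen_ball.mem_nhds hyh)) (by fun_prop)
  have hev := hcont.eventually (lt_mem_nhds hlt)
  have hca : ContinuousAt (fun y => y + h • v) y := by fun_prop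
  obtain ⟨z, hz4, hz1, hz2, hz3⟩ := ((mem_closure_iff_frequently.1 (hdense y)).and_eventually
    (hev.and ((Metric.isOpen_ball.eventually_mem hy).and
      (hca.eventually (Metric.isOpen_ball.eventually_mem hyh))))).exists
  exact absurd (hgood z hz2 hz3 hz4) (not_le.2 hz1)

/-- `V'(x; v) ≤ max_{p ∈ ∂V(x)} pᵀv` for a Lipschitz function. -/
theorem lineDeriv_le_of_inner_le {V : E → ℝ} {x v : E} {B : Set E} {K : NNReal}
    (hB : B ∈ 𝓝 x) (hV : LipschitzOnWith K V B) {c d : ℝ}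
    (hp : ∀ p ∈ clarkeGradient V x, inner ℝ p v ≤ c) (hd : HasLineDerivAt ℝ V d x v) : d ≤ c := by
  refine le_of_forall_pos_le_add fun ε hε => ?_
  obtain ⟨r, hr, hrB⟩ := Metric.mem_nhds_iff.1
    (inter_mem hB (exists_fderiv_le_of_inner_le hB hV hε hp))
  refine le_of_tendsto hd.tendsto_slope_zero_right ?_
  have h2 : Tendsto (fun h : ℝ => x + h • v) (𝓝[>] 0) (𝓝 x) := by
    have : Continuous (fun h : ℝ => x + h • v) := by fun_prop
    simpa using (this.tendsto 0).mono_left nhdsWithin_le_nhds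
  filter_upwards [h2.eventually (Metric.ball_mem_nhds x hr), self_mem_nhdsWithin] with h hh hpos
  have hpos : 0 < h := hpos
  rw [smul_eq_mul, inv_mul_le_iff₀ hpos, mul_comm]
  exact sub_le_of_fderiv_le (hV.mono fun y hy => (hrB hy).1) (fun y hy => (hrB hy).2) hpos.le
    (Metric.mem_ball_self hr) hh

end DiffIncl

namespace DiffIncl

/-! ### Set-valued maps on compact sets and near points -/

theorem LocallyBoundedOver.exists_bound {E : Type*} [NormedAddCommGroup E] {F : E → Set E} {D K : Set E}
    (hF : LocallyBoundedOver F D) (hK : IsCompact K) (hKD : K ⊆ D) :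
    ∃ M > 0, ∀ y ∈ K, F y ⊆ Metric.closedBall 0 M := by
  have hb : Bornology.IsBounded (⋃ y ∈ K, F y) := by
    refine hK.induction_on (p := fun s => Bornology.IsBounded (⋃ y ∈ s, F y)) (by simp)
      (fun s t hst ht => ht.subset (biUnion_subset_biUnion_left hst))
      (fun s t hs ht => by rw [biUnion_union]; exact hs.union ht) fun x hx => ?_
    obtain ⟨N, hN, hb⟩ := hF x (hKD hx)
    exact ⟨N, mem_nhdsWithin_of_mem_nhds hN, hb⟩
  obtain ⟨M, hM, hMs⟩ := hb.subset_closedBall_lt 0 0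
  exact ⟨M, hM, fun y hy => (subset_biUnion_of_mem (u := F) hy).trans hMs⟩

/-- One fixed ultrafilter serves all times at once, replacing a diagonal extraction of subsequences.
-/
theorem exists_hyperfilter_limit {E : Type*} [TopologicalSpace E] {K : Set E} (hK : IsCompact K) {z : ℕ → E} (hz : ∀ k, z k ∈ K) :
    ∃ y ∈ K, Tendsto z (hyperfilter ℕ) (𝓝 y) :=
  hK.ultrafilter_le_nhds' ((hyperfilter ℕ).map z) (Ultrafilter.mem_map.2 (univ_mem' hz))

variable {E : Type*} [NormedAddCommGroup E] [InnerProductSpace ℝ E]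

theorem OuterSemicontinuousOver.eventually_subset_cthickening [FiniteDimensional ℝ E]
    {F : E → Set E} {D : Set E} (hF : OuterSemicontinuousOver F D) (hFb : LocallyBoundedOver F D)
    {x : E} (hx : x ∈ D) {ε : ℝ} (hε : 0 < ε) :
    ∀ᶠ y in 𝓝 x, F y ⊆ Metric.cthickening ε (F x) := by
  by_contra hcon
  obtain ⟨u, hu, hn⟩ := exists_seq_forall_of_frequently (not_eventually.1 hcon)
  choose q hq hqn using fun i => not_subset.1 (hn i)
  obtain ⟨N, hN, hb⟩ := hFb x hx
  obtain ⟨v, -, φ, hφ, hlim⟩ := tendsto_subseq_of_frequently_bounded hb (x := q)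
    (Eventually.frequently ((hu.eventually hN).mono fun n hn => mem_biUnion hn (hq n)))
  have hv : v ∈ F x := hF x hx (u ∘ φ) (q ∘ φ) v (hu.comp hφ.tendsto_atTop) (fun i => hq _) hlim
  have hnhds : Metric.cthickening ε (F x) ∈ 𝓝 v :=
    mem_of_superset (Metric.isOpen_thickening.mem_nhds (Metric.self_subset_thickening hε _ hv))
      (Metric.thickening_subset_cthickening ε _)
  obtain ⟨i, hi⟩ := (hlim.eventually hnhds).exists
  exact hqn _ hi

/-! ### Curves whose difference quotients lie near the values of `F` -/

/-- The difference quotients of `y` near each `t ∈ I` are close to `F (y t)`: a form of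
`y' ∈ F y` on `I` that is stable under pointwise limits. -/
def HasSlopesIn (F : E → Set E) (I : Set ℝ) (y : ℝ → E) : Prop :=
  ∀ t ∈ I, ∀ ε > 0, ∃ δ > 0, ∀ s ∈ I, ∀ s' ∈ I, dist s t < δ → dist s' t < δ → s < s' →
    slope y s s' ∈ Metric.cthickening ε (F (y t))

theorem HasSlopesIn.deriv_mem {F : E → Set E} {I : Set ℝ} {y : ℝ → E} (hy : HasSlopesIn F I y)
    {t : ℝ} (hI : I ∈ 𝓝 t) (hF : IsClosed (F (y t))) (hd : DifferentiableAt ℝ y t) :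
    deriv y t ∈ F (y t) := by
  rw [← hF.closure_eq, Metric.closure_eq_iInter_cthickening]
  refine mem_iInter₂.2 fun ε hε => ?_
  obtain ⟨δ, hδ, h⟩ := hy t (mem_of_mem_nhds hI) ε hε
  refine Metric.isClosed_cthickening.mem_of_tendsto
    (hd.hasDerivAt.tendsto_slope.mono_left
      (nhdsWithin_mono t fun s (hs : t < s) => hs.ne') : Tendsto _ (𝓝[>] t) _) ?_
  filter_upwards [mem_nhdsWithin_of_mem_nhds hI, self_mem_nhdsWithin,
    mem_nhdsWithin_of_mem_nhds (Metric.ball_mem_nhds t hδ)] with s hs hlt hball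
  exact h t (mem_of_mem_nhds hI) s hs (by simpa) hball hlt

/-- Pointwise limits of approximate solutions. -/
theorem hasSlopesIn_of_tendsto [FiniteDimensional ℝ E] {F : E → Set E} {D : Set E}
    (hFb : LocallyBoundedOver F D) (hFosc : OuterSemicontinuousOver F D)
    (hFc : ∀ x ∈ D, Convex ℝ (F x)) {ι : Type*} {l : Filter ι} [l.NeBot] {I : Set ℝ}
    (hI : I.OrdConnected) {z : ι → ℝ → E} {y : ℝ → E} {M : ℝ} (hM : 0 ≤ M) {η : ι → ℝ}
    (hlim : ∀ t ∈ I, Tendsto (fun k => z k t) l (𝓝 (y t))) (hy : ∀ t ∈ I, y t ∈ D)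
    (hη : Tendsto η l (𝓝 0))
    (hequi : ∀ k, ∀ s ∈ I, ∀ s' ∈ I, dist (z k s) (z k s') ≤ M * (dist s s' + η k))
    (hslope : ∀ s ∈ I, ∀ s' ∈ I, s < s' → ∃ c : ι → ℝ, Tendsto c l (𝓝 1) ∧
      ∀ᶠ k in l, ∀ C : Set E, Convex ℝ C → IsClosed C → (∀ r ∈ Icc s s', F (z k r) ⊆ C) →
        c k • slope (z k) s s' ∈ C) :
    LipschitzOnWith M.toNNReal y I ∧ HasSlopesIn F I y := by
  constructor
  · refine LipschitzOnWith.of_dist_le_mul fun s hs s' hs' => ?_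
    rw [Real.coe_toNNReal M hM]
    have h := (hη.const_add (dist s s')).const_mul M
    rw [add_zero] at h
    exact le_of_tendsto_of_tendsto' ((hlim s hs).dist (hlim s' hs')) h
      fun k => hequi k s hs s' hs'
  intro t ht ε hε
  obtain ⟨ρ, hρ, hsub⟩ := Metric.eventually_nhds_iff.1
    (hFosc.eventually_subset_cthickening hFb (hy t ht) hε)
  -- Three errors of size `ρ / 3`: the motion `M * dist r t`, the defect `M * η k`, and `dist (z k
  -- t) (y t)`. `M + 1` avoids dividing by zero.
  refine ⟨ρ / (3 * (M + 1)), by positivity, fun s hs s' hs' hst hst' hlt => ?_⟩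
  obtain ⟨c, hc, hcs⟩ := hslope s hs s' hs' hlt
  have hsl : Tendsto (fun k => c k • slope (z k) s s') l (𝓝 ((1 : ℝ) • slope y s s')) := by
    refine hc.smul ?_
    simp only [slope_def_module]
    exact ((hlim s' hs').sub (hlim s hs)).const_smul _
  rw [one_smul] at hsl
  refine Metric.isClosed_cthickening.mem_of_tendsto hsl ?_
  have h1 : ∀ᶠ k in l, M * η k < ρ / 3 := by
    have := hη.const_mul M
    rw [mul_zero] at this
    exact this.eventually_lt_const (by positivity)
  have h2 : ∀ᶠ k in l, dist (z k t) (y t) < ρ / 3 :=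
    (hlim t ht).eventually (Metric.ball_mem_nhds _ (by positivity))
  filter_upwards [hcs, h1, h2] with k hk h1 h2
  refine hk _ ((hFc _ (hy t ht)).cthickening ε) Metric.isClosed_cthickening fun r hr => hsub ?_
  have hrt : dist r t ≤ ρ / (3 * (M + 1)) := by
    rw [Real.dist_eq] at *
    rw [abs_lt] at hst hst'
    rw [abs_le]
    constructor <;> linarith [hr.1, hr.2]
  have h3 := hequi k r (hI.out hs hs' hr) t ht
  have h4 : M * dist r t ≤ ρ / 3 := by
    calc M * dist r t ≤ (M + 1) * (ρ / (3 * (M + 1))) := by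
          gcongr; linarith
      _ = ρ / 3 := by field_simp
  linarith [dist_triangle (z k r) (z k t) (y t)]

/-! ### Local existence by Euler's method -/

/-- The Euler iterates of the vector field `f` with step `h`. -/
def euler (f : E → E) (x₀ : E) (h : ℝ) : ℕ → E
  | 0 => x₀
  | j + 1 => euler f x₀ h j + h • f (euler f x₀ h j)

theorem euler_sub (f : E → E) (x₀ : E) (h : ℝ) {i j : ℕ} (hij : i ≤ j) :
    euler f x₀ h j - euler f x₀ h i = ∑ l ∈ Finset.Ico i j, h • f (euler f x₀ h l) := by
  rw [← Finset.sum_Ico_sub _ hij]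
  exact Finset.sum_congr rfl fun l _ => by simp [euler]

theorem dist_euler_le {f : E → E} {M : ℝ} (hf : ∀ y, ‖f y‖ ≤ M) (x₀ : E) {h : ℝ} (hh : 0 ≤ h)
    {i j : ℕ} (hij : i ≤ j) :
    dist (euler f x₀ h i) (euler f x₀ h j) ≤ M * (((j : ℝ) - i) * h) := by
  have := dist_le_Ico_sum_of_dist_le hij (f := euler f x₀ h) (d := fun _ => h * M) fun _ _ => by
    rw [euler, dist_self_add_right, norm_smul, Real.norm_of_nonneg hh]
    gcongr
    exact hf _
  rw [Finset.sum_const, Nat.card_Ico, nsmul_eq_mul, Nat.cast_sub hij] at this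
  calc _ ≤ _ := this
    _ = _ := by ring

/-- Euler step functions for an arbitrary selection of `F` stay in a closed ball up to time `r / M`;
their ultrafilter limit is the solution. The selection needs no regularity, and is set to `0` off
the ball so that its bound is global. -/
theorem exists_local_solution [FiniteDimensional ℝ E] {F : E → Set E} {D : Set E}
    (hDo : IsOpen D) (hFb : LocallyBoundedOver F D) (hFosc : OuterSemicontinuousOver F D)
    (hFn : ∀ x ∈ D, (F x).Nonempty) (hFc : ∀ x ∈ D, Convex ℝ (F x)) {x₀ : E} (hx₀ : x₀ ∈ D) :
    ∃ τ > 0, ∃ y : ℝ → E, y 0 = x₀ ∧ (∀ t ∈ Icc 0 τ, y t ∈ D) ∧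
      (∃ K, LipschitzOnWith K y (Icc 0 τ)) ∧ HasSlopesIn F (Icc 0 τ) y := by
  obtain ⟨r, hr, hrD⟩ := Metric.nhds_basis_closedBall.mem_iff.1 (hDo.mem_nhds hx₀)
  have hcpt : IsCompact (Metric.closedBall x₀ r) := isCompact_closedBall x₀ r
  obtain ⟨M, hM, hFM⟩ := hFb.exists_bound hcpt hrD
  have hsel : ∀ y, ∃ q, ‖q‖ ≤ M ∧ (y ∈ Metric.closedBall x₀ r → q ∈ F y) := by
    intro y
    by_cases hy : y ∈ Metric.closedBall x₀ r
    · obtain ⟨q, hq⟩ := hFn y (hrD hy)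
      exact ⟨q, mem_closedBall_zero_iff.1 (hFM y hy hq), fun _ => hq⟩
    · exact ⟨0, by simpa using hM.le, fun h => absurd h hy⟩
  choose f hfM hfF using hsel
  set N : ℕ → ℝ := fun k => (k : ℝ) + 1 with hN
  have hNpos : ∀ k, 0 < N k := fun k => by positivity
  have hNlim : Tendsto N (hyperfilter ℕ) atTop :=
    (tendsto_atTop_add_const_right _ _ tendsto_natCast_atTop_atTop).mono_left
      Nat.hyperfilter_le_atTop
  set z : ℕ → ℝ → E := fun k t => euler f x₀ (N k)⁻¹ ⌊t * N k⌋₊ with hz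
  have hzball : ∀ k, ∀ t ∈ Icc 0 (r / M), z k t ∈ Metric.closedBall x₀ r := by
    intro k t ht
    have h1 := dist_euler_le hfM x₀ (inv_nonneg.2 (hNpos k).le) (Nat.zero_le ⌊t * N k⌋₊)
    have h2 := Nat.floor_le (mul_nonneg ht.1 (hNpos k).le)
    rw [Metric.mem_closedBall, dist_comm]
    refine h1.trans ?_
    have h3 : (⌊t * N k⌋₊ : ℝ) * (N k)⁻¹ ≤ t := by
      rw [← div_eq_mul_inv, div_le_iff₀ (hNpos k)]; exact h2
    have h4 := ht.2
    rw [le_div_iff₀ hM] at h4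
    rw [Nat.cast_zero, sub_zero]
    nlinarith
  have hex : ∀ t, ∃ y, t ∈ Icc 0 (r / M) → y ∈ Metric.closedBall x₀ r ∧
      Tendsto (fun k => z k t) (hyperfilter ℕ) (𝓝 y) := by
    intro t
    by_cases ht : t ∈ Icc 0 (r / M)
    · obtain ⟨y, hy, hlim⟩ := exists_hyperfilter_limit hcpt fun k => hzball k t ht
      exact ⟨y, fun _ => ⟨hy, hlim⟩⟩
    · exact ⟨0, fun h => absurd h ht⟩
  choose y hy using hex
  have hequi : ∀ k, ∀ s ∈ Icc 0 (r / M), ∀ s' ∈ Icc 0 (r / M), s ≤ s' →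
      dist (z k s) (z k s') ≤ M * (dist s s' + (N k)⁻¹) := by
    intro k s hs s' hs' hle
    have hfl : ⌊s * N k⌋₊ ≤ ⌊s' * N k⌋₊ :=
      Nat.floor_le_floor (mul_le_mul_of_nonneg_right hle (hNpos k).le)
    refine (dist_euler_le hfM x₀ (inv_nonneg.2 (hNpos k).le) hfl).trans ?_
    rw [dist_comm, Real.dist_eq, abs_of_nonneg (sub_nonneg.2 hle)]
    have h1 := Nat.floor_le (mul_nonneg hs'.1 (hNpos k).le)
    have h2 := Nat.lt_floor_add_one (s * N k)
    refine mul_le_mul_of_nonneg_left ?_ hM.le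
    rw [← div_eq_mul_inv, div_le_iff₀ (hNpos k), add_mul, inv_mul_cancel₀ (hNpos k).ne']
    linarith
  have hτ : 0 < r / M := div_pos hr hM
  have hmain := hasSlopesIn_of_tendsto hFb hFosc hFc (l := (hyperfilter ℕ : Filter ℕ))
    (ordConnected_Icc (a := (0 : ℝ)) (b := r / M)) (z := z) (y := y) hM.le
    (η := fun k => (N k)⁻¹) (fun t ht => (hy t ht).2) (fun t ht => hrD (hy t ht).1)
    (tendsto_inv_atTop_zero.comp hNlim) ?_ ?_
  · refine ⟨r / M, hτ, y, ?_, fun t ht => hrD (hy t ht).1, ⟨_, hmain.1⟩, hmain.2⟩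
    refine tendsto_nhds_unique (hy 0 ⟨le_rfl, hτ.le⟩).2 ?_
    simp [hz, euler]
  · intro k s hs s' hs'
    rcases le_total s s' with h | h
    · exact hequi k s hs s' hs' h
    · rw [dist_comm, dist_comm s]; exact hequi k s' hs' s hs h
  · intro s hs s' hs' hlt
    -- `m k` is the distance between the grid points below `s` and `s'`. Rescaling the slope by `(s'
    -- - s) / m k`, which tends to `1`, makes it an exact average of selected velocities.
    set m : ℕ → ℝ := fun k => ((⌊s' * N k⌋₊ : ℝ) / N k - (⌊s * N k⌋₊ : ℝ) / N k) with hm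
    have hmlim : Tendsto m (hyperfilter ℕ) (𝓝 (s' - s)) :=
      ((tendsto_nat_floor_mul_div_atTop hs'.1).comp hNlim).sub
        ((tendsto_nat_floor_mul_div_atTop hs.1).comp hNlim)
    have hpos : 0 < s' - s := sub_pos.2 hlt
    refine ⟨fun k => (s' - s) / m k, ?_, ?_⟩
    · have := (tendsto_const_nhds (x := s' - s)).div hmlim hpos.ne'
      rwa [div_self hpos.ne'] at this
    filter_upwards [hmlim.eventually_const_lt hpos] with k hk C hC _ hFC
    have hmk : m k * N k = (⌊s' * N k⌋₊ : ℝ) - ⌊s * N k⌋₊ := by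
      simp only [hm]; field_simp [(hNpos k).ne']
    have hfl : ⌊s * N k⌋₊ < ⌊s' * N k⌋₊ := by
      have := mul_pos hk (hNpos k)
      rw [hmk, sub_pos] at this
      exact_mod_cast this
    have heq : ((s' - s) / m k) • slope (z k) s s' =
        ∑ l ∈ Finset.Ico ⌊s * N k⌋₊ ⌊s' * N k⌋₊,
          (m k * N k)⁻¹ • f (euler f x₀ (N k)⁻¹ l) := by
      rw [slope_def_module, smul_smul, euler_sub f x₀ _ hfl.le, Finset.smul_sum]
      refine Finset.sum_congr rfl fun l _ => ?_
      rw [smul_smul]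
      congr 1
      field_simp
    rw [heq]
    refine hC.sum_mem (fun _ _ => inv_nonneg.2 (mul_pos hk (hNpos k)).le) ?_ fun l hl => ?_
    · rw [Finset.sum_const, Nat.card_Ico, nsmul_eq_mul, Nat.cast_sub hfl.le, ← hmk,
        mul_inv_cancel₀ (mul_pos hk (hNpos k)).ne']
    · rw [Finset.mem_Ico] at hl
      -- The first grid point may precede `s`, but its Euler value is still `z k s`.
      have hr : ∃ ρ ∈ Icc s s', ⌊ρ * N k⌋₊ = l := by
        rcases hl.1.eq_or_lt with h | h
        · exact ⟨s, ⟨le_rfl, hlt.le⟩, h⟩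
        · refine ⟨l / N k, ⟨?_, ?_⟩, ?_⟩
          · rw [le_div_iff₀ (hNpos k)]
            exact (Nat.lt_of_floor_lt h).le
          · rw [div_le_iff₀ (hNpos k)]
            exact (Nat.le_floor_iff (mul_nonneg hs'.1 (hNpos k).le)).1 hl.2.le
          · rw [div_mul_cancel₀ _ (hNpos k).ne', Nat.floor_natCast]
      obtain ⟨ρ, hρ, hρl⟩ := hr
      have h1 : euler f x₀ (N k)⁻¹ l = z k ρ := by simp only [hz, hρl]
      rw [h1]
      exact hFC ρ hρ (hfF _ (hzball k ρ ⟨hs.1.trans hρ.1, hρ.2.trans hs'.2⟩))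

end DiffIncl

namespace DiffIncl

theorem _root_.LocallyLipschitzOn.comp_lipschitzOnWith {α : Type*} [PseudoEMetricSpace α]
    {E : Type*} [PseudoEMetricSpace E] {W : E → ℝ} {D : Set E} (hW : LocallyLipschitzOn D W) {x : α → E} {I : Set α} {L : NNReal}
    (hx : LipschitzOnWith L x I) (hxD : MapsTo x I D) : LocallyLipschitzOn I (fun t => W (x t)) := by
  intro t ht
  obtain ⟨K, s, hs, hK⟩ := hW (hxD ht)
  have hpre : x ⁻¹' s ∈ 𝓝[I] t :=
    (hx.continuousOn t ht).tendsto_nhdsWithin hxD hs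
  exact ⟨K * L, x ⁻¹' s ∩ I, inter_mem hpre self_mem_nhdsWithin,
    hK.comp (hx.mono inter_subset_right) fun r hr => hr.1⟩

variable {E : Type*} [NormedAddCommGroup E] [InnerProductSpace ℝ E]

/-! ### Solutions -/

theorem ordConnected_timeInterval (t₀ : ℝ) (T : EReal) : (timeInterval t₀ T).OrdConnected :=
  ⟨fun _ hs _ hs' _ hr =>
    ⟨hs.1.trans hr.1, (EReal.coe_le_coe_iff.2 hr.2).trans_lt hs'.2⟩⟩

theorem timeInterval_mem_nhds {t₀ t : ℝ} {T : EReal} (ht : t ∈ timeInterval t₀ T) (h : t₀ < t) :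
    timeInterval t₀ T ∈ 𝓝 t := by
  filter_upwards [lt_mem_nhds h, continuous_coe_real_ereal.continuousAt.eventually
    (gt_mem_nhds ht.2)] with s h1 h2
  exact ⟨h1.le, h2⟩

theorem timeInterval_coe (t₀ T : ℝ) : timeInterval t₀ T = Ico t₀ T := by
  ext t; simp [timeInterval]

theorem timeInterval_top (t₀ : ℝ) : timeInterval t₀ ⊤ = Ici t₀ := by
  ext t; simp [timeInterval]

theorem IsSolution.slope_mem {F : E → Set E} {t₀ : ℝ} {T : EReal} {x : ℝ → E}
    (hx : IsSolution F t₀ T x) {C : Set E} (hCc : Convex ℝ C) (hC : IsClosed C) {s s' : ℝ}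
    (hs : s ∈ timeInterval t₀ T) (hs' : s' ∈ timeInterval t₀ T) (hlt : s < s')
    (hFC : ∀ r ∈ Icc s s', F (x r) ⊆ C) : slope x s s' ∈ C := by
  refine slope_mem_of_deriv_mem hlt ((hx.2.1 s' hs').mono ?_) hCc hC ?_
  · rw [uIcc_of_le hlt.le, uIcc_of_le hs'.1]
    exact Icc_subset_Icc_left hs.1
  · filter_upwards [hx.2.2] with t ht hmem
    obtain ⟨h1, h2⟩ := ht ((ordConnected_timeInterval t₀ T).out hs hs' hmem)
    exact ⟨h1, hFC t hmem h2⟩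

theorem IsSolution.lipschitzOnWith {F : E → Set E} {t₀ : ℝ} {T : EReal} {x : ℝ → E}
    (hx : IsSolution F t₀ T x) {M : ℝ} (hM : 0 ≤ M) {I : Set ℝ} (hI : I.OrdConnected)
    (hIT : I ⊆ timeInterval t₀ T) (hFM : ∀ t ∈ I, F (x t) ⊆ Metric.closedBall 0 M) :
    LipschitzOnWith M.toNNReal x I := by
  have key : ∀ s ∈ I, ∀ s' ∈ I, s < s' → dist (x s) (x s') ≤ M * dist s s' := by
    intro s hs s' hs' hlt
    have h := hx.slope_mem (convex_closedBall 0 M) Metric.isClosed_closedBall (hIT hs) (hIT hs')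
      hlt fun r hr => hFM r (hI.out hs hs' hr)
    have hpos : 0 < s' - s := sub_pos.2 hlt
    rw [mem_closedBall_zero_iff, slope_def_module, norm_smul, norm_inv,
      Real.norm_of_nonneg hpos.le, inv_mul_le_iff₀ hpos] at h
    rw [dist_comm, dist_eq_norm, dist_comm s, Real.dist_eq, abs_of_pos hpos, mul_comm]
    exact h
  refine LipschitzOnWith.of_dist_le_mul fun s hs s' hs' => ?_
  rw [Real.coe_toNNReal M hM]
  rcases lt_trichotomy s s' with h | h | h
  · exact key s hs s' hs' h
  · simp [h]
  · rw [dist_comm, dist_comm s]; exact key s' hs' s hs h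

variable [FiniteDimensional ℝ E]

theorem isSolution_of_lipschitzOnWith {F : E → Set E} {t₀ : ℝ} {T : EReal} {x : ℝ → E}
    (hT : (t₀ : EReal) < T) {K : NNReal} (hx : LipschitzOnWith K x (timeInterval t₀ T))
    (hd : ∀ᵐ t, t ∈ timeInterval t₀ T → t₀ < t → DifferentiableAt ℝ x t → deriv x t ∈ F (x t)) :
    IsSolution F t₀ T x := by
  refine ⟨hT, fun b hb => ?_, ?_⟩
  · refine (hx.mono ?_).absolutelyContinuousOnInterval
    rw [uIcc_of_le hb.1]
    exact (ordConnected_timeInterval t₀ T).out ⟨le_rfl, hT⟩ hb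
  · filter_upwards [hd, hx.ae_differentiableWithinAt_of_mem_real,
      (measure_eq_zero_iff_ae_notMem.1 (Real.volume_singleton (a := t₀)))] with t h1 h2 h3 hmem
    have hlt : t₀ < t := lt_of_le_of_ne hmem.1 fun h => h3 h.symm
    have hdt := (h2 hmem).differentiableAt (timeInterval_mem_nhds hmem hlt)
    exact ⟨hdt, h1 hmem hlt hdt⟩

/-- A solution over a bounded interval that stays in a compact subset of `D` can be extended. -/
theorem IsSolution.exists_extension {F : E → Set E} {D K : Set E}
    (hDo : IsOpen D) (hFb : LocallyBoundedOver F D) (hFosc : OuterSemicontinuousOver F D)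
    (hFval : ∀ x ∈ D, (F x).Nonempty ∧ Convex ℝ (F x) ∧ IsCompact (F x))
    (hK : IsCompact K) (hKD : K ⊆ D) {t₀ T : ℝ} {x : ℝ → E} (hx : IsSolution F t₀ T x)
    (hxK : ∀ t ∈ timeInterval t₀ T, x t ∈ K) :
    ∃ T' : ℝ, T < T' ∧ ∃ z, IsSolution F t₀ T' z ∧ ∀ t ∈ timeInterval t₀ T, z t = x t := by
  obtain ⟨M, hM, hFM⟩ := hFb.exists_bound hK hKD
  have htT : t₀ < T := EReal.coe_lt_coe_iff.1 hx.1
  have hlip : LipschitzOnWith M.toNNReal x (timeInterval t₀ T) :=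
    hx.lipschitzOnWith hM.le (ordConnected_timeInterval t₀ T) subset_rfl
      fun t ht => hFM _ (hxK t ht)
  -- The value `x T` is meaningless; the Lipschitz extension supplies the left limit at `T`, from
  -- which a local solution restarts.
  obtain ⟨g, hg, hgx⟩ := hlip.extend_finite_dimension
  set L := lipschitzExtensionConstant E * M.toNNReal
  rw [timeInterval_coe] at hgx hxK
  have hgT : g T ∈ D := by
    refine hKD (hK.isClosed.mem_of_tendsto
      ((hg.continuous.tendsto T).mono_left nhdsWithin_le_nhds : Tendsto g (𝓝[<] T) _) ?_)
    filter_upwards [self_mem_nhdsWithin, mem_nhdsWithin_of_mem_nhds (lt_mem_nhds htT)] with t h1 h2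
    rw [← hgx ⟨h2.le, h1⟩]
    exact hxK t ⟨h2.le, h1⟩
  obtain ⟨τ, hτ, y, hy0, hyD, ⟨L', hyL⟩, hyF⟩ := exists_local_solution hDo hFb hFosc
    (fun x hx => (hFval x hx).1) (fun x hx => (hFval x hx).2.1) hgT
  set z : ℝ → E := fun t => if t < T then g t else y (t - T)
  have hz₁ : ∀ t < T, z t = g t := fun t ht => if_pos ht
  have hz₂ : ∀ t, T ≤ t → z t = y (t - T) := fun t ht => if_neg ht.not_gt
  have hzlip : LipschitzOnWith (max L L') z (timeInterval t₀ ((T + τ : ℝ) : EReal)) := by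
    rw [timeInterval_coe]
    have h1 : ∀ s s', dist (g s) (g s') ≤ (max L L' : NNReal) * dist s s' := fun s s' =>
      (hg.dist_le_mul s s').trans (by gcongr; exact le_max_left _ _)
    have h2 : ∀ s, T ≤ s → s < T + τ → ∀ s', T ≤ s' → s' < T + τ →
        dist (y (s - T)) (y (s' - T)) ≤ (max L L' : NNReal) * dist s s' := by
      intro s hs hs2 s' hs' hs2'
      refine (hyL.dist_le_mul _ ⟨by linarith, by linarith⟩ _ ⟨by linarith, by linarith⟩).trans ?_
      rw [dist_sub_right]
      gcongr
      exact le_max_right _ _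
    have h3 : ∀ s < T, ∀ s', T ≤ s' → s' < T + τ →
        dist (g s) (y (s' - T)) ≤ (max L L' : NNReal) * dist s s' := by
      intro s hs s' hs' hs2'
      have ha := h1 s T
      have hb := h2 T le_rfl (by linarith) s' hs' hs2'
      rw [sub_self, hy0] at hb
      have hc : dist s s' = dist s T + dist T s' := by
        simp only [Real.dist_eq]
        rw [abs_of_nonpos (by linarith), abs_of_nonpos (by linarith), abs_of_nonpos (by linarith)]
        ring
      rw [hc, mul_add]
      exact (dist_triangle _ _ _).trans (add_le_add ha hb)
    refine LipschitzOnWith.of_dist_le_mul fun s hs s' hs' => ?_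
    rcases lt_or_ge s T with h | h <;> rcases lt_or_ge s' T with h' | h'
    · rw [hz₁ s h, hz₁ s' h']; exact h1 s s'
    · rw [hz₁ s h, hz₂ s' h']; exact h3 s h s' h' hs'.2
    · rw [hz₂ s h, hz₁ s' h', dist_comm, dist_comm s]; exact h3 s' h' s h hs.2
    · rw [hz₂ s h, hz₂ s' h']; exact h2 s h hs.2 s' h' hs'.2
  refine ⟨T + τ, by linarith, z, isSolution_of_lipschitzOnWith
    (EReal.coe_lt_coe_iff.2 (by linarith)) hzlip ?_, fun t ht => ?_⟩
  · filter_upwards [hx.2.2, (measure_eq_zero_iff_ae_notMem.1 (Real.volume_singleton (a := T)))]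
      with t hxt htne hmem hlt hdz
    rw [timeInterval_coe] at hmem hxt
    rcases lt_or_ge t T with h | h
    · have hev : z =ᶠ[𝓝 t] x := by
        filter_upwards [lt_mem_nhds hlt, gt_mem_nhds h] with s h1 h2
        rw [hz₁ s h2, hgx ⟨h1.le, h2⟩]
      rw [hev.deriv_eq, hev.eq_of_nhds]
      exact (hxt ⟨hlt.le, h⟩).2
    · have h : T < t := lt_of_le_of_ne h fun h => htne h.symm
      have hev : z =ᶠ[𝓝 t] fun s => y (s - T) := by
        filter_upwards [lt_mem_nhds h] with s hs
        exact hz₂ s hs.le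
      have hmem' : t - T ∈ Icc 0 τ := ⟨by linarith, by linarith [hmem.2]⟩
      have hdy : DifferentiableAt ℝ y (t - T) := by
        have h1 : DifferentiableAt ℝ (fun s => y (s - T)) t := hdz.congr_of_eventuallyEq hev.symm
        exact (differentiableAt_comp_sub_const).1 h1
      rw [hev.deriv_eq, hev.eq_of_nhds, deriv_comp_sub_const]
      exact hyF.deriv_mem (Icc_mem_nhds (by linarith) (by linarith [hmem.2]))
        (hFval _ (hyD _ hmem')).2.2.isClosed hdy
  · rw [timeInterval_coe] at ht
    rw [hz₁ t ht.2, hgx ht]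

theorem IsMaximalSolution.eq_top {F : E → Set E} {D K : Set E}
    (hDo : IsOpen D) (hFb : LocallyBoundedOver F D) (hFosc : OuterSemicontinuousOver F D)
    (hFval : ∀ x ∈ D, (F x).Nonempty ∧ Convex ℝ (F x) ∧ IsCompact (F x))
    (hK : IsCompact K) (hKD : K ⊆ D) {t₀ : ℝ} {T : EReal} {x : ℝ → E}
    (hx : IsMaximalSolution F t₀ T x) (hxK : ∀ t ∈ timeInterval t₀ T, x t ∈ K) : T = ⊤ := by
  by_contra hne
  lift T to ℝ using ⟨hne, (bot_le.trans_lt hx.1.1).ne'⟩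
  obtain ⟨T', hlt, z, hz, hzx⟩ := hx.1.exists_extension hDo hFb hFosc hFval hK hKD hxK
  have := hx.2 T' z hz (EReal.coe_le_coe_iff.2 hlt.le) hzx
  exact hlt.ne' (EReal.coe_injective this)

/-! ### Monotonicity of `V` along solutions -/

theorem lyapunov_le {F : E → Set E} {D : Set E} (hDo : IsOpen D) {V : E → ℝ}
    (hVLip : LocallyLipschitzOn D V) {U : ℕ → E → ℝ} (hULip : ∀ i, LocallyLipschitzOn D (U i))
    (hUreg : ∀ i, RegularOn (U i) D) (hder : ∀ x ∈ D, genDeriv D F U V x ≤ 0)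
    {x : ℝ → E} {a b : ℝ} (hab : a ≤ b) {L : NNReal} (hx : LipschitzOnWith L x (Icc a b))
    (hxD : MapsTo x (Icc a b) D)
    (hsol : ∀ᵐ t, t ∈ Icc a b → DifferentiableAt ℝ x t ∧ deriv x t ∈ F (x t)) :
    V (x b) ≤ V (x a) := by
  have hac : ∀ W : E → ℝ, LocallyLipschitzOn D W →
      AbsolutelyContinuousOnInterval (fun t => W (x t)) a b := by
    intro W hW
    obtain ⟨K, hK⟩ := (hW.comp_lipschitzOnWith hx hxD).exists_lipschitzOnWith_of_compact
      isCompact_Icc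
    exact LipschitzOnWith.absolutelyContinuousOnInterval (K := K) (by rwa [uIcc_of_le hab])
  have hnhds : ∀ W : E → ℝ, LocallyLipschitzOn D W → ∀ y ∈ D, ∃ K, ∃ B ∈ 𝓝 y,
      LipschitzOnWith K W B := by
    intro W hW y hy
    obtain ⟨K, B, hB, hK⟩ := hW hy
    exact ⟨K, B, by rwa [hDo.nhdsWithin_eq hy] at hB, hK⟩
  have hle := sub_le_of_deriv_le (c := 0) hab (hac V hVLip) ?_
  · linarith
  filter_upwards [hsol, (hac V hVLip).ae_differentiableAt,
    ae_all_iff.2 fun i => (hac (U i) (hULip i)).ae_differentiableAt] with t h1 h2 h3 hmem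
  rw [uIcc_of_le hab] at h2 h3
  obtain ⟨hxd, hxF⟩ := h1 hmem
  have hD := hxD hmem
  have hline : ∀ W : E → ℝ, LocallyLipschitzOn D W → DifferentiableAt ℝ (fun t => W (x t)) t →
      HasLineDerivAt ℝ W (deriv (fun t => W (x t)) t) (x t) (deriv x t) := by
    intro W hW hd
    obtain ⟨K, B, hB, hK⟩ := hnhds W hW _ hD
    exact hasLineDerivAt_of_comp hB hK hxd.hasDerivAt hd.hasDerivAt
  have hinner : ∀ W : E → ℝ, LocallyLipschitzOn D W → RegularOn W D →
      DifferentiableAt ℝ (fun t => W (x t)) t → ∀ p ∈ clarkeGradient W (x t),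
      inner ℝ p (deriv x t) = deriv (fun t => W (x t)) t := by
    intro W hW hreg hd p hp
    obtain ⟨K, B, hB, hK⟩ := hnhds W hW _ hD
    exact inner_eq_of_regular hB hK (hreg _ hD) (hline W hW hd) hp
  have hred : deriv x t ∈ reducedInclusion F U (x t) :=
    mem_iInter.2 fun i => ⟨hxF, _, hinner (U i) (hULip i) (hUreg i) (h3 i hmem)⟩
  have hgd := hder _ hD
  unfold genDeriv at hgd
  split_ifs at hgd with hreg
  -- All `p` give the same product with `deriv x t`, so the infimum over `p` already bounds the
  -- derivative.
  · rw [← EReal.coe_le_coe_iff]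
    refine le_trans (le_iInf₂ fun p hp => ?_) hgd
    rw [← hinner V hVLip hreg (h2 hmem) p hp]
    exact le_iSup₂ (f := fun q _ => ((inner ℝ p q : ℝ) : EReal)) _ hred
  · obtain ⟨K, B, hB, hK⟩ := hnhds V hVLip _ hD
    refine lineDeriv_le_of_inner_le hB hK (fun p hp => ?_) (hline V hVLip (h2 hmem))
    rw [← EReal.coe_le_coe_iff]
    refine le_trans (le_trans ?_ (le_iSup₂
      (f := fun p _ => ⨆ q ∈ reducedInclusion F U (x t), ((inner ℝ p q : ℝ) : EReal)) p hp)) hgd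
    exact le_iSup₂ (f := fun q _ => ((inner ℝ p q : ℝ) : EReal)) _ hred

end DiffIncl

namespace DiffIncl

variable {E : Type*} [NormedAddCommGroup E] [InnerProductSpace ℝ E]

/-! ### Stability -/

theorem IsSolution.continuousOn {F : E → Set E} {t₀ : ℝ} {T : EReal} {x : ℝ → E}
    (hx : IsSolution F t₀ T x) {b : ℝ} (hb : b ∈ timeInterval t₀ T) :
    ContinuousOn x (Icc t₀ b) := by
  have := (hx.2.1 b hb).continuousOn
  rwa [uIcc_of_le hb.1] at this

variable [FiniteDimensional ℝ E]

theorem IsSolution.lyapunov_le {F : E → Set E} {D : Set E} (hDo : IsOpen D)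
    (hFb : LocallyBoundedOver F D) {V : E → ℝ} (hVLip : LocallyLipschitzOn D V) {U : ℕ → E → ℝ}
    (hULip : ∀ i, LocallyLipschitzOn D (U i)) (hUreg : ∀ i, RegularOn (U i) D)
    (hder : ∀ x ∈ D, genDeriv D F U V x ≤ 0) {t₀ : ℝ} {T : EReal} {x : ℝ → E}
    (hx : IsSolution F t₀ T x) {a b : ℝ} (hab : a ≤ b) (ha : a ∈ timeInterval t₀ T)
    (hb : b ∈ timeInterval t₀ T) (hxD : MapsTo x (Icc a b) D) : V (x b) ≤ V (x a) := by
  have hI := (ordConnected_timeInterval t₀ T).out ha hb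
  have hcpt : IsCompact (x '' Icc a b) :=
    isCompact_Icc.image_of_continuousOn ((hx.continuousOn hb).mono (Icc_subset_Icc_left ha.1))
  obtain ⟨M, hM, hFM⟩ := hFb.exists_bound hcpt hxD.image_subset
  refine DiffIncl.lyapunov_le hDo hVLip hULip hUreg hder hab
    (hx.lipschitzOnWith hM.le ordConnected_Icc hI fun t ht => hFM _ (mem_image_of_mem x ht)) hxD ?_
  filter_upwards [hx.2.2] with t ht hmem
  exact ht (hI hmem)

theorem PositiveDefiniteOn.exists_pos_le {E : Type*} [NormedAddCommGroup E] {V : E → ℝ} {D S : Set E}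
    (hV : PositiveDefiniteOn V D) (hVc : ContinuousOn V D) (hS : IsCompact S) (hSD : S ⊆ D)
    (h0 : (0 : E) ∉ S) : ∃ m > 0, ∀ y ∈ S, m ≤ V y := by
  rcases S.eq_empty_or_nonempty with rfl | hne
  -- This occurs for spheres in dimension zero.
  · exact ⟨1, one_pos, by simp⟩
  · obtain ⟨y, hy, hmin⟩ := hS.exists_isMinOn hne (hVc.mono hSD)
    exact ⟨V y, hV.2 y (hSD hy) (ne_of_mem_of_not_mem hy h0), hmin⟩

/-- With `m` a lower bound of `V` on the sphere of radius `ε`, a solution starting where `V < m`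
cannot reach that sphere, since `V` does not increase before the first hitting time. -/
theorem exists_trapping_radius {F : E → Set E} {D : Set E} (hDo : IsOpen D)
    (hFb : LocallyBoundedOver F D) (hFosc : OuterSemicontinuousOver F D)
    (hFval : ∀ x ∈ D, (F x).Nonempty ∧ Convex ℝ (F x) ∧ IsCompact (F x))
    {V : E → ℝ} (hVLip : LocallyLipschitzOn D V) (hVpos : PositiveDefiniteOn V D) {U : ℕ → E → ℝ}
    (hULip : ∀ i, LocallyLipschitzOn D (U i)) (hUreg : ∀ i, RegularOn (U i) D)
    (hder : ∀ x ∈ D, genDeriv D F U V x ≤ 0) (t₀ : ℝ) {ε : ℝ} (hε : 0 < ε)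
    (hεD : Metric.closedBall 0 ε ⊆ D) :
    ∃ δ > 0, ∀ (T : EReal) (x : ℝ → E), IsMaximalSolution F t₀ T x →
      x t₀ ∈ Metric.closedBall 0 δ → T = ⊤ ∧ ∀ t ≥ t₀, x t ∈ Metric.closedBall 0 ε := by
  have hVc : ContinuousOn V D := hVLip.continuousOn
  obtain ⟨m, hm, hmV⟩ := hVpos.exists_pos_le hVc (isCompact_sphere 0 ε)
    (Metric.sphere_subset_closedBall.trans hεD) (by simp [hε.ne])
  have h0D : (0 : E) ∈ D := hεD (Metric.mem_closedBall_self hε.le)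
  have hev : ∀ᶠ y in 𝓝 (0 : E), V y < m ∧ y ∈ Metric.ball 0 ε := by
    refine ((hVc.continuousAt (hDo.mem_nhds h0D)).eventually (gt_mem_nhds ?_)).and
      (Metric.ball_mem_nhds 0 hε)
    rwa [hVpos.1]
  obtain ⟨δ, hδ, hδs⟩ := Metric.nhds_basis_closedBall.mem_iff.1 hev
  refine ⟨δ, hδ, fun T x hx hx0 => ?_⟩
  have htrap : ∀ t ∈ timeInterval t₀ T, x t ∈ Metric.closedBall 0 ε := by
    intro t₁ ht₁
    by_contra hout
    rw [mem_closedBall_zero_iff, not_le] at hout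
    have hcont := (hx.1.continuousOn ht₁).norm
    have hclosed := hcont.preimage_isClosed_of_isClosed isClosed_Icc (isClosed_Ici (a := ε))
    obtain ⟨s, ⟨hs, hsε⟩, hmin⟩ := (isCompact_Icc.of_isClosed_subset hclosed
      inter_subset_left).exists_isLeast ⟨t₁, ⟨ht₁.1, le_rfl⟩, hout.le⟩
    have hsT := (ordConnected_timeInterval t₀ T).out ⟨le_rfl, hx.1.1⟩ ht₁ hs
    have h0ε : ‖x t₀‖ < ε := mem_ball_zero_iff.1 (hδs hx0).2
    obtain ⟨r, hr, hrε⟩ := intermediate_value_Icc hs.1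
      (hcont.mono (Icc_subset_Icc_right hs.2)) ⟨h0ε.le, hsε⟩
    have hrs : r = s :=
      le_antisymm hr.2 (hmin ⟨⟨hr.1, hr.2.trans hs.2⟩, (show ε ≤ ‖x r‖ from hrε.ge)⟩)
    subst hrs
    have hin : MapsTo x (Icc t₀ r) D := by
      intro t ht
      refine hεD (mem_closedBall_zero_iff.2 ?_)
      by_contra! hlt
      have := hmin ⟨⟨ht.1, ht.2.trans hs.2⟩, hlt.le⟩
      rw [le_antisymm ht.2 this] at hlt
      exact hlt.ne' hrε
    have h1 := hx.1.lyapunov_le hDo hFb hVLip hULip hUreg hder hs.1 ⟨le_rfl, hx.1.1⟩ hsT hin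
    have h2 := hmV (x r) (mem_sphere_zero_iff_norm.2 hrε)
    linarith [(hδs hx0).1]
  have hT := hx.eq_top hDo hFb hFosc hFval (isCompact_closedBall 0 ε) hεD htrap
  subst hT
  rw [timeInterval_top] at htrap
  exact ⟨rfl, fun t ht => htrap t ht⟩

/-! ### Invariance principle and convergence to the origin -/

/-- The limit of the translates of a complete solution in a compact set is a complete solution on
which `V` takes its limit value. -/
theorem IsSolution.exists_limit_solution {F : E → Set E} {D K : Set E}
    (hFb : LocallyBoundedOver F D) (hFosc : OuterSemicontinuousOver F D)
    (hFval : ∀ x ∈ D, (F x).Nonempty ∧ Convex ℝ (F x) ∧ IsCompact (F x))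
    (hK : IsCompact K) (hKD : K ⊆ D) {V : E → ℝ} (hVc : ContinuousOn V D) {t₀ ν : ℝ} {x : ℝ → E}
    (hx : IsSolution F t₀ ⊤ x) (hxK : ∀ t ≥ t₀, x t ∈ K)
    (hlim : Tendsto (fun t => V (x t)) atTop (𝓝 ν)) :
    ∃ y : ℝ → E, IsSolution F t₀ ⊤ y ∧ ∀ t ≥ t₀, y t ∈ {y ∈ D | V y = ν} := by
  obtain ⟨M, hM, hFM⟩ := hFb.exists_bound hK hKD
  have hmem : ∀ {t : ℝ}, t ≥ t₀ → t ∈ timeInterval t₀ ⊤ := fun h => by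
    rwa [timeInterval_top]
  have hlip := hx.lipschitzOnWith hM.le (ordConnected_timeInterval t₀ ⊤) subset_rfl
    fun t ht => hFM _ (hxK t ht.1)
  have hshift : ∀ t ≥ t₀, ∀ k : ℕ, t + k ≥ t₀ := fun t ht k => by
    have := Nat.cast_nonneg (α := ℝ) k
    linarith
  have hex : ∀ t, ∃ y, t₀ ≤ t → y ∈ K ∧
      Tendsto (fun k : ℕ => x (t + k)) (hyperfilter ℕ) (𝓝 y) := by
    intro t
    by_cases ht : t₀ ≤ t
    · obtain ⟨y, hy, hlim⟩ := exists_hyperfilter_limit hK fun k => hxK _ (hshift t ht k)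
      exact ⟨y, fun _ => ⟨hy, hlim⟩⟩
    · exact ⟨0, fun h => absurd h ht⟩
  choose y hy using hex
  -- Translates are exact solutions, so the defect is `0` and the slope correction is `1`.
  have hmain := hasSlopesIn_of_tendsto hFb hFosc (fun x hx => (hFval x hx).2.1)
    (l := (hyperfilter ℕ : Filter ℕ)) (ordConnected_timeInterval t₀ ⊤)
    (z := fun k t => x (t + k)) (y := y) hM.le (η := fun _ => 0)
    (fun t ht => (hy t ht.1).2) (fun t ht => hKD (hy t ht.1).1) tendsto_const_nhds ?_ ?_
  · refine ⟨y, isSolution_of_lipschitzOnWith (EReal.coe_lt_top t₀) hmain.1 ?_, fun t ht => ?_⟩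
    · exact Eventually.of_forall fun t ht hlt hd => hmain.2.deriv_mem
        (timeInterval_mem_nhds ht hlt) (hFval _ (hKD (hy t ht.1).1)).2.2.isClosed hd
    · have hyD := hKD (hy t ht).1
      refine ⟨hyD, ?_⟩
      have h1 : Tendsto (fun k : ℕ => V (x (t + k))) (hyperfilter ℕ) (𝓝 (V (y t))) :=
        (hVc (y t) hyD).tendsto.comp (tendsto_nhdsWithin_iff.2
          ⟨(hy t ht).2, Eventually.of_forall fun k => hKD (hxK _ (hshift t ht k))⟩)
      have h2 : Tendsto (fun k : ℕ => V (x (t + k))) (hyperfilter ℕ) (𝓝 ν) :=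
        hlim.comp ((tendsto_atTop_add_const_left _ t tendsto_natCast_atTop_atTop).mono_left
          Nat.hyperfilter_le_atTop)
      exact tendsto_nhds_unique h1 h2
  · intro k s hs s' hs'
    have := hlip.dist_le_mul _ (hmem (hshift s hs.1 k)) _ (hmem (hshift s' hs'.1 k))
    rwa [Real.coe_toNNReal M hM.le, dist_add_right, ← add_zero (dist s s')] at this
  · intro s hs s' hs' hlt
    refine ⟨fun _ => 1, tendsto_const_nhds, Eventually.of_forall fun k C hCc hC hFC => ?_⟩
    have h1 : slope (fun t => x (t + k)) s s' = slope x (s + k) (s' + k) := by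
      simp [slope_def_module]
    rw [one_smul, h1]
    refine hx.slope_mem hCc hC (hmem (hshift s hs.1 k)) (hmem (hshift s' hs'.1 k)) (by linarith)
      fun r hr => ?_
    have := hFC (r - k) ⟨by linarith [hr.1], by linarith [hr.2]⟩
    rwa [sub_add_cancel] at this

theorem IsSolution.tendsto_norm_zero {F : E → Set E} {D K : Set E} (hDo : IsOpen D)
    (hFb : LocallyBoundedOver F D) (hFosc : OuterSemicontinuousOver F D)
    (hFval : ∀ x ∈ D, (F x).Nonempty ∧ Convex ℝ (F x) ∧ IsCompact (F x))
    {V : E → ℝ} (hVLip : LocallyLipschitzOn D V) (hVpos : PositiveDefiniteOn V D) {U : ℕ → E → ℝ}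
    (hULip : ∀ i, LocallyLipschitzOn D (U i)) (hUreg : ∀ i, RegularOn (U i) D)
    (hder : ∀ x ∈ D, genDeriv D F U V x ≤ 0) {t₀ : ℝ}
    (hlevel : ∀ ν : ℝ, 0 < ν → ¬ ∃ x : ℝ → E,
      IsSolution F t₀ ⊤ x ∧ ∀ t ≥ t₀, x t ∈ {y ∈ D | V y = ν})
    (hK : IsCompact K) (hKD : K ⊆ D) {x : ℝ → E}
    (hx : IsSolution F t₀ ⊤ x) (hxK : ∀ t ≥ t₀, x t ∈ K) :
    Tendsto (fun t => ‖x t‖) atTop (𝓝 0) := by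
  have hVc : ContinuousOn V D := hVLip.continuousOn
  have hVnn : ∀ y ∈ D, 0 ≤ V y := fun y hy => by
    rcases eq_or_ne y 0 with rfl | hne
    · exact hVpos.1.ge
    · exact (hVpos.2 y hy hne).le
  -- Freezing time before `t₀`, where `x` is arbitrary, gives a function monotone on all of `ℝ`.
  have hanti : Antitone fun t => V (x (max t₀ t)) := by
    intro s s' hss
    refine hx.lyapunov_le hDo hFb hVLip hULip hUreg hder (max_le_max le_rfl hss) ?_ ?_
      fun t ht => hKD (hxK t ((le_max_left _ _).trans ht.1))
    all_goals rw [timeInterval_top, mem_Ici]; exact le_max_left _ _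
  have hlim := tendsto_atTop_ciInf hanti
    ⟨0, by rintro _ ⟨t, rfl⟩; exact hVnn _ (hKD (hxK _ (le_max_left _ _)))⟩
  set ν := ⨅ t, V (x (max t₀ t))
  have hlim' : Tendsto (fun t => V (x t)) atTop (𝓝 ν) := by
    refine hlim.congr' ?_
    filter_upwards [eventually_ge_atTop t₀] with t ht
    rw [max_eq_right ht]
  have hν0 : 0 ≤ ν := le_ciInf fun t => hVnn _ (hKD (hxK _ (le_max_left _ _)))
  have hν : ν = 0 := by
    by_contra hne
    exact hlevel ν (lt_of_le_of_ne hν0 (Ne.symm hne))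
      (hx.exists_limit_solution hFb hFosc hFval hK hKD hVc hxK hlim')
  rw [hν] at hlim'
  rw [← tendsto_zero_iff_norm_tendsto_zero, Metric.nhds_basis_ball.tendsto_right_iff]
  intro η hη
  -- `V` is bounded away from `0` on `K` minus the ball, so `V (x t) → 0` forces `x t` into the
  -- ball.
  obtain ⟨m, hm, hmV⟩ := hVpos.exists_pos_le hVc (hK.diff Metric.isOpen_ball (t := Metric.ball 0 η))
    (sdiff_subset.trans hKD) (fun h => h.2 (Metric.mem_ball_self hη))
  filter_upwards [hlim'.eventually (gt_mem_nhds hm), eventually_ge_atTop t₀] with t h1 h2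
  by_contra hn
  exact absurd (hmV _ ⟨hxK t h2, hn⟩) (not_le.2 h1)

end DiffIncl

/-! ### Local and global asymptotic stability -/

theorem mainTheorem8 (n : ℕ) (t₀ : ℝ)
    (D : Set (EuclideanSpace ℝ (Fin n))) (hDo : IsOpen D) (hDc : IsConnected D)
    (h0 : (0 : EuclideanSpace ℝ (Fin n)) ∈ D)
    (V : EuclideanSpace ℝ (Fin n) → ℝ) (hVLip : LocallyLipschitzOn D V)
    (hVpos : DiffIncl.PositiveDefiniteOn V D)
    (F : EuclideanSpace ℝ (Fin n) → Set (EuclideanSpace ℝ (Fin n)))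
    (hFb : DiffIncl.LocallyBoundedOver F D)
    (hFosc : DiffIncl.OuterSemicontinuousOver F D)
    (hFval : ∀ x ∈ D, (F x).Nonempty ∧ Convex ℝ (F x) ∧ IsCompact (F x))
    (U : ℕ → EuclideanSpace ℝ (Fin n) → ℝ)
    (hULip : ∀ i, LocallyLipschitzOn D (U i))
    (hUreg : ∀ i, DiffIncl.RegularOn (U i) D)
    (hder : ∀ x ∈ D, DiffIncl.genDeriv D F U V x ≤ 0)
    (hlevel : ∀ ν : ℝ, 0 < ν → ¬ ∃ x : ℝ → EuclideanSpace ℝ (Fin n),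
      DiffIncl.IsSolution F t₀ ⊤ x ∧ ∀ t ≥ t₀, x t ∈ {y ∈ D | V y = ν}) :
    DiffIncl.IsAsymptoticallyStable F t₀ ∧
    (D = Set.univ → (∀ l : ℝ, 0 ≤ l → IsCompact {x | V x ≤ l}) →
      DiffIncl.IsGloballyAsymptoticallyStable F t₀) := by
  obtain ⟨R, hR, hRD⟩ := Metric.nhds_basis_closedBall.mem_iff.1 (hDo.mem_nhds h0)
  have hstable : DiffIncl.IsStable F t₀ := by
    intro ε hε
    obtain ⟨δ, hδ, h⟩ := DiffIncl.exists_trapping_radius hDo hFb hFosc hFval hVLip hVpos hULip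
      hUreg hder t₀ (lt_min hε hR)
      ((Metric.closedBall_subset_closedBall (min_le_right _ _)).trans hRD)
    exact ⟨δ, hδ, fun T x hx hx0 => (h T x hx hx0).imp_right fun hin t ht =>
      Metric.closedBall_subset_closedBall (min_le_left _ _) (hin t ht)⟩
  refine ⟨⟨hstable, ?_⟩, ?_⟩
  · obtain ⟨c, hc, h⟩ := DiffIncl.exists_trapping_radius hDo hFb hFosc hFval hVLip hVpos hULip
      hUreg hder t₀ hR hRD
    refine ⟨c, hc, fun T x hx hx0 => ?_⟩
    obtain ⟨rfl, hin⟩ := h T x hx hx0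
    exact ⟨rfl, hx.1.tendsto_norm_zero hDo hFb hFosc hFval hVLip hVpos hULip hUreg hder hlevel
      (isCompact_closedBall 0 R) hRD hin⟩
  · rintro rfl hcpt
    refine ⟨hstable, fun T x hx => ?_⟩
    have hV0 : 0 ≤ V (x t₀) := by
      rcases eq_or_ne (x t₀) 0 with h | h
      · rw [h, hVpos.1]
      · exact (hVpos.2 _ (mem_univ _) h).le
    have hK := hcpt _ hV0
    -- The initial sublevel set is itself a compact trap, so no barrier is needed.
    have hin : ∀ t ∈ DiffIncl.timeInterval t₀ T, x t ∈ {y | V y ≤ V (x t₀)} := fun t ht =>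
      hx.1.lyapunov_le hDo hFb hVLip hULip hUreg hder ht.1 ⟨le_rfl, hx.1.1⟩ ht (mapsTo_univ _ _)
    obtain rfl := hx.eq_top hDo hFb hFosc hFval hK (subset_univ _) hin
    rw [DiffIncl.timeInterval_top] at hin
    exact ⟨rfl, hx.1.tendsto_norm_zero hDo hFb hFosc hFval hVLip hVpos hULip hUreg hder hlevel
      hK (subset_univ _) fun t ht => hin t ht⟩
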